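/- Let $q$ be a prime power and $m\ge 1$ an integer. Let $g_1,g_2\in\mathbb F_q[x]$ be monic divisors of $x^m-1$, put $h_i=(x^m-1)/g_i$ for $i=1,2$, and let $v_1,v_2\in\mathbb F_q[x]$ satisfy $\gcd(v_1v_2-1,\,x^m-1)=1$. For $k\in\mathbb F_q[x]$ let $[k]\in\mathbb F_q^m$ be the coefficient vector of $k$ reduced modulo $x^m-1$, and let $\overline k(x)=k(x^{-1})$, computed modulo $x^m-1$ (where $x^{-1}=x^{m-1}$). Let $\mathcal C=\{([a_1g_1+a_2v_2g_2],\,[a_1v_1g_1+a_2g_2]) : a_1,a_2\in\mathbb F_q[x]\}\subseteq\mathbb F_q^{2m}$ be the 2-generator quasi-cyclic code generated by $([g_1],[v_1g_1])$ and $([v_2g_2],[g_2])$. On $\mathbb F_q^{2m}$ let $\langle u,v\rangle_S=\sum_{i=1}^m(u_iv_{m+i}-u_{m+i}v_i)$, let $\mathcal C^{\perp_S}=\{u : \langle u,c\rangle_S=0\ \text{for all } c\in\mathcal C\}$, and let $w_s(u)=|\{i : (u_i,u_{m+i})\ne(0,0)\}|$ be the symplectic weight. Suppose that $$h_1\mid\overline{g_1}\,(\overline{v_1}-v_1),\qquad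 h_1\mid\overline{g_2}\,(1-\overline{v_2}\,v_1),\qquad h_2\mid\overline{g_2}\,(v_2-\overline{v_2}).$$ Then $\mathcal C\subseteq\mathcal C^{\perp_S}$ (that is, $\mathcal C$ is symplectic self-orthogonal) and $\dim\mathcal C=2m-\deg g_1-\deg g_2$; in particular $\deg g_1+\deg g_2\ge m$. Moreover there exists a quantum stabilizer code with parameters $$[[\,m,\ \deg g_1+\deg g_2-m,\ w_s(\mathcal C^{\perp_S}\setminus\mathcal C)\,]]_q ,$$ where $w_s(\mathcal C^{\perp_S}\setminus\mathcal C)$ is the minimum symplectic weight of the vectors in $\mathcal C^{\perp_S}\setminus\mathcal C$ ($\infty$ if this set is empty). Here the error group on $m$ qudits is the group of operators on $\mathbb C^{q^m}$ (with orthonormal basis $|x\rangle$, $x\in\mathbb F_q^m$) generated by $X(a)|x\rangle=|x+a\rangle$ and $Z(b)|x\rangle=e^{2\pi i\,\mathrm{tr}(b\cdot x)/p}|x\rangle$ for $a,b\in\mathbb F_q^m$, where $p$ is the characteristic of $\mathbb F_q$ and $\mathrm{tr}:\mathbb F_q\to\mathbb F_p$ is the trace; a scalar multiple of $X(a)Z(b)$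 has weight $w_s(a,b)$. An $[[n,k,d]]_q$ stabilizer code is a $q^k$-dimensional joint eigenspace $Q\subseteq\mathbb C^{q^n}$ of an abelian subgroup of the error group on $n$ qudits that detects every error $E$ in the error group of weight less than $d$ (that is, $PEP$ is a scalar multiple of $P$, with $P$ the orthogonal projection onto $Q$), $d\in\mathbb N\cup\{\infty\}$ being the largest value with this property. -/

import Mathlib

open Polynomial

noncomputable section

namespace QCStab

/-! ### Quasi-cyclic codes of index two -/

section Codes

variable {F : Type*} [Field F]

/-- `k` reduced modulo `x ^ m - 1`: the representative of degree `< m` of the class of `k` in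
`R = F[x] / (x ^ m - 1)`. -/
def reduce (m : ℕ) : F[X] →ₗ[F] F[X] :=
  modByMonicHom (X ^ m - 1)

/-- The coefficient vector `[k(x)] = (k₀, k₁, …, k_{m-1})` of the class of `k` in `R`. -/
def coeffVec (m : ℕ) : F[X] →ₗ[F] (Fin m → F) :=
  LinearMap.pi fun i => (lcoeff F (i : ℕ)) ∘ₗ reduce m

/-- The conjugate `k(x⁻¹) mod (x ^ m - 1) = k₀ + k_{m-1} x + ⋯ + k₁ x ^ (m-1)`; in `R` the inverse
of `x` is `x ^ (m-1)`. -/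
def conj (m : ℕ) (k : F[X]) : F[X] :=
  reduce m (k.comp (X ^ (m - 1)))

/-- Vectors of length `2m`, written as the pair of their first and second halves. -/
abbrev Vec (F : Type*) (m : ℕ) : Type _ := (Fin m → F) × (Fin m → F)

/-- The quasi-cyclic code of index two and length `2m` generated by the vectors `([a(x)], [b(x)])`
with `(a, b)` in `gens`: all `R`-linear combinations of the generators. -/
def qcCode (m : ℕ) (gens : Set (F[X] × F[X])) : Submodule F (Vec F m) :=
  ((Submodule.span F[X] gens).restrictScalars F).map ((coeffVec m).prodMap (coeffVec m))

/-- The code generated by `([g₁], [v₁ g₁])` and `([v₂ g₂], [g₂])`. -/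
def twoGenCode (m : ℕ) (g₁ g₂ v₁ v₂ : F[X]) : Submodule F (Vec F m) :=
  qcCode m {(g₁, v₁ * g₁), (v₂ * g₂, g₂)}

/-- The symplectic inner product `∑ (u_i v_{m+i} - u_{m+i} v_i)`. -/
def sympInner {m : ℕ} (u v : Vec F m) : F :=
  ∑ i, (u.1 i * v.2 i - u.2 i * v.1 i)

/-- The symplectic dual code. -/
def sympDual {m : ℕ} (C : Submodule F (Vec F m)) : Submodule F (Vec F m) where
  carrier := {u | ∀ c ∈ C, sympInner u c = 0}
  zero_mem' := by
    intro c _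
    simp [sympInner]
  add_mem' := by
    intro u v hu hv c hc
    have h : sympInner (u + v) c = sympInner u c + sympInner v c := by
      simp only [sympInner, ← Finset.sum_add_distrib, Prod.fst_add, Prod.snd_add, Pi.add_apply]
      exact Finset.sum_congr rfl fun i _ => by ring
    rw [h, hu c hc, hv c hc, add_zero]
  smul_mem' := by
    intro r u hu c hc
    have h : sympInner (r • u) c = r * sympInner u c := by
      simp only [sympInner, Finset.mul_sum, Prod.smul_fst, Prod.smul_snd, Pi.smul_apply,
        smul_eq_mul]
      exact Finset.sum_congr rfl fun i _ => by ring
    rw [h, hu c hc, mul_zero]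

/-- Symplectic self-orthogonality `C ⊆ C^⊥`. -/
def IsSympSelfOrthogonal {m : ℕ} (C : Submodule F (Vec F m)) : Prop :=
  C ≤ sympDual C

/-- The symplectic weight: the number of `i` with `(u_i, u_{m+i}) ≠ (0, 0)`. -/
def sympWeight [DecidableEq F] {m : ℕ} (u : Vec F m) : ℕ :=
  (Finset.univ.filter fun i => (u.1 i, u.2 i) ≠ (0, 0)).card

/-- The minimum symplectic weight of a set of vectors (`⊤` for the empty set). -/
def minSympWeight [DecidableEq F] {m : ℕ} (S : Set (Vec F m)) : ℕ∞ :=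
  ⨅ u ∈ S, (sympWeight u : ℕ∞)

end Codes

/-! ### Quantum stabilizer codes -/

section Quantum

variable (F : Type*) [Field F] [Fintype F] (n : ℕ)

/-- The Hilbert space `ℂ^(q^n)` of `n` qudits, with orthonormal basis `|x⟩`, `x ∈ F^n`. -/
abbrev StateSpace : Type _ := EuclideanSpace ℂ (Fin n → F)

/-- The additive character `x ↦ exp (2 π i tr(x) / p)` of `F`, with `p` the characteristic and
`tr` the absolute trace `F → ℤ/p`. -/
def traceChar : AddChar F ℂ :=
  haveI : NeZero (ringChar F) := ⟨CharP.ringChar_ne_zero_of_finite F⟩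
  letI : Algebra (ZMod (ringChar F)) F := ZMod.algebra F (ringChar F)
  (ZMod.stdAddChar (N := ringChar F)).compAddMonoidHom
    (Algebra.trace (ZMod (ringChar F)) F).toAddMonoidHom

variable {F n}

/-- The shift error `X(a) |x⟩ = |x + a⟩`. -/
def shiftOp (a : Fin n → F) : StateSpace F n ≃ₗ[ℂ] StateSpace F n :=
  (LinearIsometryEquiv.piLpCongrLeft 2 ℂ ℂ (Equiv.addRight a)).toLinearEquiv

/-- The phase error `Z(b) |x⟩ = exp (2 π i tr(b ⬝ x) / p) |x⟩`. -/
def phaseOp (b : Fin n → F) : StateSpace F n ≃ₗ[ℂ] StateSpace F n where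
  toFun ψ := WithLp.toLp 2 fun x => traceChar F (b ⬝ᵥ x) * ψ x
  invFun ψ := WithLp.toLp 2 fun x => traceChar F (-(b ⬝ᵥ x)) * ψ x
  map_add' ψ φ := by
    ext x
    simp [mul_add]
  map_smul' c ψ := by
    ext x
    simp [mul_left_comm]
  left_inv ψ := by
    ext x
    simp [← mul_assoc, ← AddChar.map_add_eq_mul]
  right_inv ψ := by
    ext x
    simp [← mul_assoc, ← AddChar.map_add_eq_mul]

variable (F n) in
/-- The error group on `n` qudits: the group of operators generated by all shift and phase
errors. -/
def errorGroup : Subgroup (StateSpace F n ≃ₗ[ℂ] StateSpace F n) :=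
  Subgroup.closure (Set.range shiftOp ∪ Set.range phaseOp)

/-- `E` is a scalar multiple of `X(a) Z(b)` with `(a, b)` of symplectic weight `w`, that is, `E`
acts nontrivially on exactly `w` of the `n` qudits. -/
def HasErrorWeight [DecidableEq F] (E : StateSpace F n ≃ₗ[ℂ] StateSpace F n) (w : ℕ) : Prop :=
  ∃ (a b : Fin n → F) (z : ℂ), (∀ ψ, E ψ = z • shiftOp a (phaseOp b ψ)) ∧ sympWeight (a, b) = w

/-- The code `Q` detects the error `E`: with `P` the orthogonal projection onto `Q`, `P E P` is a
scalar multiple of `P`. -/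
def Detects (Q : Submodule ℂ (StateSpace F n)) (E : StateSpace F n ≃ₗ[ℂ] StateSpace F n) : Prop :=
  ∃ c : ℂ, ∀ φ ∈ Q, ∀ ψ ∈ Q, inner ℂ φ (E ψ) = c * inner ℂ φ ψ

/-- `Q` detects every error of weight less than `d`. -/
def DetectsBelow [DecidableEq F] (Q : Submodule ℂ (StateSpace F n)) (d : ℕ∞) : Prop :=
  ∀ E ∈ errorGroup F n, ∀ w : ℕ, HasErrorWeight E w → (w : ℕ∞) < d → Detects Q E

/-- `Q` is a stabilizer code: a nonzero joint eigenspace of an abelian subgroup of the error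
group. -/
def IsStabilizerCode (Q : Submodule ℂ (StateSpace F n)) : Prop :=
  Q ≠ ⊥ ∧ ∃ S : Subgroup (StateSpace F n ≃ₗ[ℂ] StateSpace F n), S ≤ errorGroup F n ∧
    (∀ A ∈ S, ∀ B ∈ S, A * B = B * A) ∧
    ∃ χ : S →* ℂˣ, ∀ ψ, ψ ∈ Q ↔ ∀ A : S, A.1 ψ = (χ A : ℂ) • ψ

/-- `Q` is an `[[n, k, d]]_q` stabilizer code: it encodes `k` qudits, it detects all errors of
weight less than `d`, and `d` is the largest value with this property. (A one-dimensional code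
detects all errors, so its `d` is `⊤`.) -/
structure IsStabilizerCodeWith [DecidableEq F] (Q : Submodule ℂ (StateSpace F n)) (k : ℕ)
    (d : ℕ∞) : Prop where
  stabilizer : IsStabilizerCode Q
  dim : Module.finrank ℂ Q = Fintype.card F ^ k
  detects : DetectsBelow Q d
  sharp : ∀ d' : ℕ∞, DetectsBelow Q d' → d' ≤ d

end Quantum

end QCStab

end

open Polynomial

noncomputable section

namespace QCStab

/-! The dot product of coefficient vectors is the constant coefficient of `a(x) d(x⁻¹)`, so
multiples of generators `(a, b)` and `(c, d)` are symplectically orthogonal once `a d̄ - b c̄`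
vanishes mod `x ^ m - 1`. For the pairs of generators this is what the three divisibilities give
after multiplication by `g₁` or `g₂` (`isSympSelfOrthogonal_twoGenCode`). The generator matrix has
determinant `1 - v₁ v₂`, a unit, so the code has the dimension of `(g₁) ⊕ (g₂)`
(`finrank_twoGenCode`).

For self-orthogonal `C` the operators `X(a) Z(b)` with `(a, b) ∈ C` commute, hence have a nonzero
joint eigenspace `Q`. The projection onto `Q` is an average over `C`, and every nonidentity `X(a)
Z(b)` has trace zero, so `|C| dim Q = q ^ n`; this also forces `dim C ≤ n`. Errors from `C` act on
`Q` as scalars, errors outside the dual map `Q` into its orthogonal complement, and errors in the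
dual but not in `C` preserve `Q` without being scalar. The last kind alone is undetected, which
fixes the distance (`exists_isStabilizerCodeWith`). -/

theorem exists_joint_eigenvector {K V ι : Type*} [Field K] [IsAlgClosed K] [AddCommGroup V]
    [Module K V] [FiniteDimensional K V] [Nontrivial V] [Finite ι] (f : ι → Module.End K V)
    (hf : ∀ i j, Commute (f i) (f j)) :
    ∃ (μ : ι → K) (v : V), v ≠ 0 ∧ ∀ i, f i v = μ i • v := by
  classical
  have := Fintype.ofFinite ι
  suffices h : ∀ s : Finset ι, ∃ (μ : ι → K) (v : V), v ≠ 0 ∧ ∀ i ∈ s, f i v = μ i • v by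
    simpa using h Finset.univ
  intro s
  induction s using Finset.induction_on with
  | empty =>
    obtain ⟨v, hv⟩ := exists_ne (0 : V)
    exact ⟨0, v, hv, by simp⟩
  | insert j s hj ih =>
    obtain ⟨μ, v, hv, hμ⟩ := ih
    let W : Submodule K V := ⨅ i ∈ s, Module.End.eigenspace (f i) (μ i)
    have hW : ∀ x, x ∈ W ↔ ∀ i ∈ s, f i x = μ i • x := by
      intro x
      simp [W, Submodule.mem_iInf]
    have hvW : v ∈ W := (hW v).2 hμ
    have : Nontrivial W := ⟨⟨⟨v, hvW⟩, 0, fun h => hv (congrArg Subtype.val h)⟩⟩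
    -- Commutation makes `W` invariant, so the next eigenvalue can be sought inside it.
    have hmap : ∀ x ∈ W, f j x ∈ W := by
      intro x hx
      rw [hW] at hx ⊢
      intro i hi
      have h := LinearMap.congr_fun (hf i j).eq x
      simp only [Module.End.mul_apply] at h
      rw [h, hx i hi, map_smul]
    obtain ⟨c, hc⟩ := Module.End.exists_eigenvalue ((f j).restrict hmap)
    obtain ⟨w, hw⟩ := hc.exists_hasEigenvector
    refine ⟨Function.update μ j c, w, fun h => hw.2 (Subtype.ext h), ?_⟩
    intro i hi
    rcases Finset.mem_insert.1 hi with rfl | hi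
    · rw [Function.update_self]
      exact congrArg Subtype.val hw.apply_eq_smul
    · rw [Function.update_of_ne (ne_of_mem_of_not_mem hi hj)]
      exact (hW w).1 w.2 i hi

/-! ### Symplectic form -/

section Symplectic

variable {F : Type*} [Field F] {m : ℕ}

theorem sympInner_eq_dotProduct (u v : Vec F m) :
    sympInner u v = u.1 ⬝ᵥ v.2 - u.2 ⬝ᵥ v.1 := by
  simp [sympInner, dotProduct, Finset.sum_sub_distrib]

theorem sympInner_smul_right (r : F) (u v : Vec F m) :
    sympInner u (r • v) = r * sympInner u v := by
  simp [sympInner_eq_dotProduct, mul_sub]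

end Symplectic

/-! ### Weyl operators: products, commutation, traces -/

section Weyl

variable {F : Type*} [Field F] [Fintype F] {n : ℕ}

theorem traceChar_apply (x : F) :
    haveI : NeZero (ringChar F) := ⟨CharP.ringChar_ne_zero_of_finite F⟩
    letI : Algebra (ZMod (ringChar F)) F := ZMod.algebra F (ringChar F)
    traceChar F x =
      ZMod.stdAddChar (N := ringChar F) (Algebra.trace (ZMod (ringChar F)) F x) :=
  rfl

theorem exists_traceChar_mul_ne_one {a : F} (ha : a ≠ 0) : ∃ b : F, traceChar F (b * a) ≠ 1 := by
  have : NeZero (ringChar F) := ⟨CharP.ringChar_ne_zero_of_finite F⟩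
  let : Algebra (ZMod (ringChar F)) F := ZMod.algebra F (ringChar F)
  obtain ⟨b, hb⟩ := FiniteField.trace_to_zmod_nondegenerate F ha
  refine ⟨b, fun h => hb ?_⟩
  rw [traceChar_apply, ← AddChar.map_zero_eq_one (ZMod.stdAddChar (N := ringChar F))] at h
  rw [mul_comm]
  exact ZMod.injective_stdAddChar h

theorem norm_traceChar (x : F) : ‖traceChar F x‖ = 1 :=
  AddChar.norm_apply _ _

theorem sum_traceChar_dotProduct {b : Fin n → F} (hb : b ≠ 0) :
    ∑ x : Fin n → F, traceChar F (b ⬝ᵥ x) = 0 := by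
  classical
  let φ : (Fin n → F) →+ F :=
    { toFun := fun x => b ⬝ᵥ x
      map_zero' := by simp
      map_add' := fun x y => dotProduct_add b x y }
  have hne : (traceChar F).compAddMonoidHom φ ≠ 1 := by
    obtain ⟨i, hi⟩ := Function.ne_iff.1 hb
    obtain ⟨c, hc⟩ := exists_traceChar_mul_ne_one hi
    intro h
    apply hc
    have := DFunLike.congr_fun h (Pi.single i c)
    simpa [φ, mul_comm] using this
  exact AddChar.sum_eq_zero_of_ne_one hne

/-- The error `X(a) Z(b)` for `u = (a, b)`. -/
def weyl (u : Vec F n) : StateSpace F n ≃ₗ[ℂ] StateSpace F n :=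
  shiftOp u.1 * phaseOp u.2

theorem shiftOp_apply (a : Fin n → F) (ψ : StateSpace F n) (x : Fin n → F) :
    shiftOp a ψ x = ψ (x - a) := by
  simp [shiftOp, sub_eq_add_neg]

theorem phaseOp_apply (b : Fin n → F) (ψ : StateSpace F n) (x : Fin n → F) :
    phaseOp b ψ x = traceChar F (b ⬝ᵥ x) * ψ x :=
  rfl

theorem weyl_apply (u : Vec F n) (ψ : StateSpace F n) (x : Fin n → F) :
    weyl u ψ x = traceChar F (u.2 ⬝ᵥ (x - u.1)) * ψ (x - u.1) := by
  change shiftOp u.1 (phaseOp u.2 ψ) x = _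
  rw [shiftOp_apply, phaseOp_apply]

theorem weyl_mem_errorGroup (u : Vec F n) : weyl u ∈ errorGroup F n :=
  mul_mem (Subgroup.subset_closure (.inl ⟨_, rfl⟩)) (Subgroup.subset_closure (.inr ⟨_, rfl⟩))

theorem weyl_weyl (u v : Vec F n) (ψ : StateSpace F n) :
    weyl u (weyl v ψ) = traceChar F (u.2 ⬝ᵥ v.1) • weyl (u + v) ψ := by
  ext x
  rw [PiLp.smul_apply, smul_eq_mul, weyl_apply, weyl_apply, weyl_apply, Prod.fst_add,
    Prod.snd_add, sub_sub, ← mul_assoc, ← mul_assoc, ← AddChar.map_add_eq_mul,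
    ← AddChar.map_add_eq_mul]
  congr 2
  simp only [add_dotProduct, dotProduct_sub, dotProduct_add]
  ring

theorem weyl_comm (u v : Vec F n) (ψ : StateSpace F n) :
    weyl v (weyl u ψ) = traceChar F (sympInner u v) • weyl u (weyl v ψ) := by
  rw [weyl_weyl, weyl_weyl, smul_smul, ← AddChar.map_add_eq_mul, add_comm v u,
    sympInner_eq_dotProduct, sub_add_cancel, dotProduct_comm]

theorem inner_weyl_weyl (u : Vec F n) (φ ψ : StateSpace F n) :
    inner ℂ (weyl u φ) (weyl u ψ) = inner ℂ φ ψ := by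
  simp only [PiLp.inner_apply, weyl_apply]
  rw [← Equiv.sum_comp (Equiv.addRight u.1)]
  refine Finset.sum_congr rfl fun x _ => ?_
  have h : traceChar F (u.2 ⬝ᵥ x) * (starRingEnd ℂ) (traceChar F (u.2 ⬝ᵥ x)) = 1 := by
    rw [Complex.mul_conj, Complex.normSq_eq_norm_sq, norm_traceChar]
    simp
  simp only [Equiv.coe_addRight, add_sub_cancel_right, RCLike.inner_apply, map_mul]
  linear_combination (ψ x * (starRingEnd ℂ) (φ x)) * h

/-- A nonzero shift leaves no diagonal entries; without a shift the trace is a nontrivial character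
sum. -/
theorem trace_weyl_of_ne_zero {u : Vec F n} (hu : u ≠ 0) :
    LinearMap.trace ℂ _ (weyl u).toLinearMap = 0 := by
  classical
  rw [LinearMap.trace_eq_sum_inner _ (EuclideanSpace.basisFun (Fin n → F) ℂ)]
  simp only [EuclideanSpace.basisFun_apply, LinearEquiv.coe_coe,
    EuclideanSpace.inner_single_left, weyl_apply, map_one, one_mul, PiLp.single_apply]
  by_cases ha : u.1 = 0
  · have hb : u.2 ≠ 0 := fun hb => hu (Prod.ext ha hb)
    simpa [ha] using sum_traceChar_dotProduct hb
  · exact Finset.sum_eq_zero fun x _ => by simp [ha]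

theorem trace_weyl_zero :
    LinearMap.trace ℂ _ (weyl (0 : Vec F n)).toLinearMap = (Fintype.card F : ℂ) ^ n := by
  have h : (weyl (0 : Vec F n)).toLinearMap = LinearMap.id := by
    refine LinearMap.ext fun ψ => ?_
    ext x
    simp [weyl_apply]
  rw [h, LinearMap.trace_id]
  simp

end Weyl

/-! ### From self-orthogonal codes to stabilizer codes -/

section Stabilizer

variable {F : Type*} [Field F] [Fintype F] {n : ℕ}

/-- The joint eigenspace of the errors `weyl u`, `u ∈ C`, with eigenvalues `μ u`. -/
def weylEigenspace (C : Submodule F (Vec F n)) (μ : C → ℂ) : Submodule ℂ (StateSpace F n) :=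
  ⨅ u : C, LinearMap.ker ((weyl u.1).toLinearMap - μ u • LinearMap.id)

theorem mem_weylEigenspace {C : Submodule F (Vec F n)} {μ : C → ℂ} {ψ : StateSpace F n} :
    ψ ∈ weylEigenspace C μ ↔ ∀ u : C, weyl u.1 ψ = μ u • ψ := by
  simp [weylEigenspace, Submodule.mem_iInf, sub_eq_zero]

theorem exists_weylEigenspace_ne_bot {C : Submodule F (Vec F n)} (hC : IsSympSelfOrthogonal C) :
    ∃ μ : C → ℂ, weylEigenspace C μ ≠ ⊥ := by
  obtain ⟨μ, ψ, hψ, h⟩ := exists_joint_eigenvector (K := ℂ) (V := StateSpace F n)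
    (fun u : C => (weyl u.1).toLinearMap) (fun u v => by
      refine LinearMap.ext fun ψ => ?_
      have h := weyl_comm u.1 v.1 ψ
      rw [hC u.2 v.1 v.2, AddChar.map_zero_eq_one, one_smul] at h
      exact h.symm)
  exact ⟨μ, (Submodule.ne_bot_iff _).2 ⟨ψ, mem_weylEigenspace.2 h, hψ⟩⟩

section Eigenspace

variable {C : Submodule F (Vec F n)} {μ : C → ℂ}

theorem weylEigenvalue_ne_zero (hQ : weylEigenspace C μ ≠ ⊥) (u : C) : μ u ≠ 0 := by
  obtain ⟨ψ, hψ, h0⟩ := (Submodule.ne_bot_iff _).1 hQ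
  intro h
  have h1 := mem_weylEigenspace.1 hψ u
  rw [h, zero_smul] at h1
  exact h0 ((weyl u.1).map_eq_zero_iff.1 h1)

/-- The eigenvalues are only a projective character of `C`, with the cocycle of `weyl_weyl`. -/
theorem weylEigenvalue_mul (hQ : weylEigenspace C μ ≠ ⊥) (u v : C) :
    μ u * μ v = traceChar F (u.1.2 ⬝ᵥ v.1.1) * μ (u + v) := by
  obtain ⟨ψ, hψ, h0⟩ := (Submodule.ne_bot_iff _).1 hQ
  rw [mem_weylEigenspace] at hψ
  have h := weyl_weyl u.1 v.1 ψ
  rw [hψ v, map_smul, hψ u, smul_smul, ← Submodule.coe_add, hψ (u + v), smul_smul] at h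
  rw [mul_comm]
  exact smul_left_injective ℂ h0 h

theorem conj_weylEigenvalue_mul_self (hQ : weylEigenspace C μ ≠ ⊥) (u : C) :
    (starRingEnd ℂ) (μ u) * μ u = 1 := by
  obtain ⟨ψ, hψ, h0⟩ := (Submodule.ne_bot_iff _).1 hQ
  have h := inner_weyl_weyl u.1 ψ ψ
  rw [mem_weylEigenspace.1 hψ u, inner_smul_left, inner_smul_right, ← mul_assoc] at h
  exact mul_right_cancel₀ (inner_self_ne_zero.2 h0) (h.trans (one_mul _).symm)

open Classical in
/-- The projection onto `weylEigenspace C μ`, as an average over `C`. -/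
def weylProj (C : Submodule F (Vec F n)) (μ : C → ℂ) : Module.End ℂ (StateSpace F n) :=
  (Fintype.card C : ℂ)⁻¹ • ∑ u : C, (μ u)⁻¹ • (weyl u.1).toLinearMap

open Classical in
theorem weylProj_apply (ψ : StateSpace F n) :
    weylProj C μ ψ = (Fintype.card C : ℂ)⁻¹ • ∑ u : C, (μ u)⁻¹ • weyl u.1 ψ := by
  simp [weylProj]

/-- The cocycles of the operators and of the eigenvalues cancel, so applying `weyl v` to the average
just translates the index and multiplies by `μ v`. -/
theorem isProj_weylProj (hQ : weylEigenspace C μ ≠ ⊥) :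
    LinearMap.IsProj (weylEigenspace C μ) (weylProj C μ) := by
  classical
  constructor
  · intro ψ
    rw [mem_weylEigenspace]
    intro v
    rw [weylProj_apply, map_smul, smul_comm (μ v), map_sum, Finset.smul_sum (r := μ v)]
    congr 1
    rw [← Equiv.sum_comp (Equiv.addLeft v) fun u : C => μ v • (μ u)⁻¹ • weyl u.1 ψ]
    refine Finset.sum_congr rfl fun u _ => ?_
    rw [map_smul, weyl_weyl, smul_smul, smul_smul, Equiv.coe_addLeft, Submodule.coe_add]
    congr 1
    have h := weylEigenvalue_mul hQ v u
    have h1 := weylEigenvalue_ne_zero hQ u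
    have h2 := weylEigenvalue_ne_zero hQ (v + u)
    field_simp
    linear_combination -h
  · intro ψ hψ
    rw [mem_weylEigenspace] at hψ
    have h : ∀ u : C, (μ u)⁻¹ • weyl u.1 ψ = ψ := fun u => by
      rw [hψ u, inv_smul_smul₀ (weylEigenvalue_ne_zero hQ u)]
    rw [weylProj_apply, Finset.sum_congr rfl fun u _ => h u, Finset.sum_const, Finset.card_univ,
      ← Nat.cast_smul_eq_nsmul ℂ, inv_smul_smul₀ (Nat.cast_ne_zero.2 Fintype.card_ne_zero)]

theorem card_mul_finrank_weylEigenspace (hQ : weylEigenspace C μ ≠ ⊥) :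
    Nat.card C * Module.finrank ℂ (weylEigenspace C μ) = Fintype.card F ^ n := by
  classical
  obtain ⟨ψ, hψ, h0⟩ := (Submodule.ne_bot_iff _).1 hQ
  have hμ : μ 0 = 1 := by
    have h := weylEigenvalue_mul hQ 0 0
    rw [Submodule.coe_zero, Prod.snd_zero, zero_dotProduct, AddChar.map_zero_eq_one, one_mul,
      add_zero] at h
    exact mul_left_cancel₀ (weylEigenvalue_ne_zero hQ 0) (h.trans (mul_one _).symm)
  have h := (isProj_weylProj hQ).trace
  rw [weylProj, map_smul, map_sum, Finset.sum_eq_single 0, map_smul, Submodule.coe_zero,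
    trace_weyl_zero, hμ, inv_one, one_smul, smul_eq_mul,
    inv_mul_eq_iff_eq_mul₀ (Nat.cast_ne_zero.2 Fintype.card_ne_zero)] at h
  · rw [Nat.card_eq_fintype_card]
    exact_mod_cast h.symm
  · intro u _ hu
    rw [map_smul, trace_weyl_of_ne_zero (fun h => hu (Subtype.ext h)), smul_zero]
  · simp

theorem trace_weyl_comp_weylProj {u : Vec F n} (hu : u ∉ C) :
    LinearMap.trace ℂ _ ((weyl u).toLinearMap ∘ₗ weylProj C μ) = 0 := by
  classical
  have h : (weyl u).toLinearMap ∘ₗ weylProj C μ = (Fintype.card C : ℂ)⁻¹ •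
      ∑ v : C, ((μ v)⁻¹ * traceChar F (u.2 ⬝ᵥ v.1.1)) • (weyl (u + v.1)).toLinearMap := by
    refine LinearMap.ext fun ψ => ?_
    simp [weylProj_apply, weyl_weyl, smul_smul, map_sum]
  rw [h, map_smul, map_sum, Finset.sum_eq_zero, smul_zero]
  intro v _
  rw [map_smul, trace_weyl_of_ne_zero, smul_zero]
  intro h0
  exact hu (by rw [eq_neg_of_add_eq_zero_left h0]; exact C.neg_mem v.2)

theorem weyl_mem_weylEigenspace {u : Vec F n} (hu : u ∈ sympDual C) {ψ : StateSpace F n}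
    (hψ : ψ ∈ weylEigenspace C μ) : weyl u ψ ∈ weylEigenspace C μ := by
  rw [mem_weylEigenspace] at hψ ⊢
  intro v
  rw [weyl_comm, hu v.1 v.2, AddChar.map_zero_eq_one, one_smul, hψ v, map_smul]

theorem not_detects_weyl (hQ : weylEigenspace C μ ≠ ⊥) {u : Vec F n} (hu : u ∈ sympDual C)
    (huC : u ∉ C) : ¬ Detects (weylEigenspace C μ) (weyl u) := by
  rintro ⟨c, hc⟩
  have hscal : ∀ ψ ∈ weylEigenspace C μ, weyl u ψ = c • ψ := by
    intro ψ hψ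
    have hmem : weyl u ψ - c • ψ ∈ weylEigenspace C μ :=
      sub_mem (weyl_mem_weylEigenspace hu hψ) (Submodule.smul_mem _ _ hψ)
    -- The difference lies in the eigenspace, and detection makes it orthogonal to the whole
    -- eigenspace, itself included.
    rw [← sub_eq_zero, ← inner_self_eq_zero (𝕜 := ℂ), inner_sub_right, hc _ hmem _ hψ,
      inner_smul_right, sub_self]
  have hP := isProj_weylProj hQ
  have h : (weyl u).toLinearMap ∘ₗ weylProj C μ = c • weylProj C μ :=
    LinearMap.ext fun ψ => hscal _ (hP.map_mem ψ)
  have htr := trace_weyl_comp_weylProj (μ := μ) huC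
  rw [h, map_smul, hP.trace, smul_eq_mul, mul_eq_zero] at htr
  obtain ⟨ψ, hψ, h0⟩ := (Submodule.ne_bot_iff _).1 hQ
  rcases htr with hc0 | hr
  · have h1 := hscal ψ hψ
    rw [hc0, zero_smul] at h1
    exact h0 ((weyl u).map_eq_zero_iff.1 h1)
  · exact hQ (Submodule.finrank_eq_zero.1 (Nat.cast_eq_zero.1 hr))

theorem inner_weyl_eq_zero (hQ : weylEigenspace C μ ≠ ⊥) {u : Vec F n} (hu : u ∉ sympDual C)
    {φ ψ : StateSpace F n} (hφ : φ ∈ weylEigenspace C μ) (hψ : ψ ∈ weylEigenspace C μ) :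
    inner ℂ φ (weyl u ψ) = 0 := by
  obtain ⟨v, hv, huv⟩ : ∃ v ∈ C, sympInner u v ≠ 0 := by
    by_contra! h
    exact hu h
  -- A nonzero symplectic product may still have trace zero; `F`-linearity of `C` allows rescaling
  -- `v` until the phase is nontrivial.
  obtain ⟨r, hr⟩ := exists_traceChar_mul_ne_one huv
  rw [← sympInner_smul_right] at hr
  let w : C := ⟨r • v, C.smul_mem r hv⟩
  have h := inner_weyl_weyl w.1 φ (weyl u ψ)
  rw [weyl_comm, mem_weylEigenspace.1 hφ w, mem_weylEigenspace.1 hψ w, map_smul,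
    inner_smul_left, inner_smul_right, inner_smul_right] at h
  have h1 := conj_weylEigenvalue_mul_self hQ w
  have h2 : (traceChar F (sympInner u w.1) - 1) * inner ℂ φ (weyl u ψ) = 0 := by
    linear_combination h - traceChar F (sympInner u w.1) * inner ℂ φ (weyl u ψ) * h1
  exact (mul_eq_zero.1 h2).resolve_left (sub_ne_zero.2 hr)

theorem isStabilizerCode_weylEigenspace (hC : IsSympSelfOrthogonal C)
    (hQ : weylEigenspace C μ ≠ ⊥) : IsStabilizerCode (weylEigenspace C μ) := by
  obtain ⟨ψ₀, hψ₀, h0⟩ := (Submodule.ne_bot_iff _).1 hQ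
  let S : Subgroup (StateSpace F n ≃ₗ[ℂ] StateSpace F n) :=
    Subgroup.closure (Set.range fun u : C => weyl u.1)
  -- `S` may also contain scalar phases, so the character is read off from the action on the
  -- eigenspace; the nonzero `ψ₀` makes it unique, hence multiplicative.
  have hscal : ∀ A : S, ∃ c : ℂˣ, ∀ ψ ∈ weylEigenspace C μ, A.1 ψ = (c : ℂ) • ψ := by
    rintro ⟨A, hA⟩
    change ∃ c : ℂˣ, ∀ ψ ∈ weylEigenspace C μ, A ψ = (c : ℂ) • ψ
    induction hA using Subgroup.closure_induction with
    | mem A hA =>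
      obtain ⟨u, rfl⟩ := hA
      exact ⟨Units.mk0 _ (weylEigenvalue_ne_zero hQ u), fun ψ hψ => mem_weylEigenspace.1 hψ u⟩
    | one => exact ⟨1, fun ψ _ => by simp⟩
    | mul A B _ _ hA hB =>
      obtain ⟨a, ha⟩ := hA
      obtain ⟨b, hb⟩ := hB
      refine ⟨a * b, fun ψ hψ => ?_⟩
      rw [LinearEquiv.mul_apply, hb ψ hψ, map_smul, ha ψ hψ, smul_smul, Units.val_mul, mul_comm]
    | inv A _ hA =>
      obtain ⟨a, ha⟩ := hA
      refine ⟨a⁻¹, fun ψ hψ => A.injective ?_⟩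
      rw [map_smul, ha ψ hψ, smul_smul, Units.inv_mul, one_smul, ← LinearEquiv.mul_apply,
        mul_inv_cancel, LinearEquiv.coe_one, id]
  choose χ hχ using hscal
  have hinj : ∀ a b : ℂˣ, (a : ℂ) • ψ₀ = (b : ℂ) • ψ₀ → a = b := fun a b h =>
    Units.ext (smul_left_injective ℂ h0 h)
  refine ⟨hQ, S, ?_, ?_, ⟨⟨χ, ?_⟩, ?_⟩, ?_⟩
  · rw [Subgroup.closure_le]
    rintro _ ⟨u, rfl⟩
    exact weyl_mem_errorGroup _
  · have hcomm : ∀ A ∈ Set.range (fun u : C => weyl u.1), ∀ B ∈ Set.range (fun u : C => weyl u.1),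
        A * B = B * A := by
      rintro _ ⟨u, rfl⟩ _ ⟨v, rfl⟩
      refine LinearEquiv.ext fun ψ => ?_
      have h := weyl_comm v.1 u.1 ψ
      rwa [hC v.2 u.1 u.2, AddChar.map_zero_eq_one, one_smul] at h
    have hSc := Subgroup.isMulCommutative_closure hcomm
    intro A hA B hB
    exact congrArg Subtype.val (hSc.is_comm.comm (⟨A, hA⟩ : S) ⟨B, hB⟩)
  · refine hinj _ _ ?_
    rw [← hχ 1 ψ₀ hψ₀]
    simp
  · intro A B
    refine hinj _ _ ?_
    rw [← hχ (A * B) ψ₀ hψ₀, Subgroup.coe_mul, LinearEquiv.mul_apply, hχ B ψ₀ hψ₀, map_smul,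
      hχ A ψ₀ hψ₀, smul_smul, Units.val_mul, mul_comm]
  · intro ψ
    refine ⟨fun hψ A => hχ A ψ hψ, fun h => mem_weylEigenspace.2 fun u => ?_⟩
    have hu : weyl u.1 ∈ S := Subgroup.subset_closure ⟨u, rfl⟩
    have h1 : (χ ⟨_, hu⟩ : ℂ) = μ u := smul_left_injective ℂ h0
      ((hχ ⟨_, hu⟩ ψ₀ hψ₀).symm.trans (mem_weylEigenspace.1 hψ₀ u))
    rw [← h1]
    exact h ⟨_, hu⟩

theorem detects_of_mem_of_eq_smul_weyl (hQ : weylEigenspace C μ ≠ ⊥) {u : Vec F n}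
    (hu : u ∈ C ∨ u ∉ sympDual C) {E : StateSpace F n ≃ₗ[ℂ] StateSpace F n} {z : ℂ}
    (hE : ∀ ψ, E ψ = z • weyl u ψ) : Detects (weylEigenspace C μ) E := by
  rcases hu with hu | hu
  · refine ⟨z * μ ⟨u, hu⟩, fun φ _ ψ hψ => ?_⟩
    rw [hE, mem_weylEigenspace.1 hψ ⟨u, hu⟩, smul_smul, inner_smul_right]
  · refine ⟨0, fun φ hφ ψ hψ => ?_⟩
    rw [hE, inner_smul_right, inner_weyl_eq_zero hQ hu hφ hψ, mul_zero, zero_mul]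

end Eigenspace

theorem exists_isStabilizerCodeWith [DecidableEq F] {C : Submodule F (Vec F n)}
    (hC : IsSympSelfOrthogonal C) :
    Module.finrank F C ≤ n ∧ ∃ Q : Submodule ℂ (StateSpace F n),
      IsStabilizerCodeWith Q (n - Module.finrank F C)
        (minSympWeight ((sympDual C : Set (Vec F n)) \ (C : Set (Vec F n)))) := by
  obtain ⟨μ, hQ⟩ := exists_weylEigenspace_ne_bot hC
  have hcard := card_mul_finrank_weylEigenspace hQ
  rw [Module.natCard_eq_pow_finrank (K := F), Nat.card_eq_fintype_card] at hcard
  have hle : Module.finrank F C ≤ n :=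
    (Nat.pow_dvd_pow_iff_le_right Fintype.one_lt_card).1 ⟨_, hcard.symm⟩
  refine ⟨hle, weylEigenspace C μ, isStabilizerCode_weylEigenspace hC hQ, ?_, ?_, ?_⟩
  · refine Nat.eq_of_mul_eq_mul_left (pow_pos (Fintype.card_pos (α := F)) (Module.finrank F C)) ?_
    rw [hcard, ← pow_add, Nat.add_sub_cancel' hle]
  · rintro E - w ⟨a, b, z, hE, rfl⟩ hw
    refine detects_of_mem_of_eq_smul_weyl hQ (u := (a, b)) (z := z) ?_ hE
    by_contra! h
    exact absurd (iInf₂_le (a, b) ⟨h.2, h.1⟩) (not_le.2 hw)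
  · intro d' hd
    refine le_iInf₂ fun u hu => not_lt.1 fun hlt => not_detects_weyl hQ hu.1 hu.2 ?_
    exact hd (weyl u) (weyl_mem_errorGroup u) _
      ⟨u.1, u.2, 1, fun ψ => (one_smul ℂ _).symm, rfl⟩ hlt

end Stabilizer

/-! ### Coefficient vectors modulo `x ^ m - 1` -/

section QuasiCyclic

variable {F : Type*} [Field F] {m : ℕ}

theorem monic_X_pow_sub_one (hm : 0 < m) : (X ^ m - 1 : F[X]).Monic :=
  monic_X_pow_sub_C 1 hm.ne'

theorem natDegree_X_pow_sub_one : (X ^ m - 1 : F[X]).natDegree = m :=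
  natDegree_X_pow_sub_C (r := (1 : F))

theorem coeffVec_apply (k : F[X]) (i : Fin m) :
    coeffVec m k i = (k %ₘ (X ^ m - 1)).coeff i :=
  rfl

theorem coeffVec_eq_zero_iff (hm : 0 < m) {k : F[X]} :
    coeffVec m k = 0 ↔ X ^ m - 1 ∣ k := by
  rw [← modByMonic_eq_zero_iff_dvd (monic_X_pow_sub_one hm)]
  constructor
  · intro h
    ext i
    rcases lt_or_ge i m with hi | hi
    · exact congrFun h ⟨i, hi⟩
    · refine coeff_eq_zero_of_degree_lt ((degree_modByMonic_lt _ (monic_X_pow_sub_one hm)).trans_le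
        ?_)
      rw [degree_eq_natDegree (monic_X_pow_sub_one hm).ne_zero, natDegree_X_pow_sub_one]
      exact_mod_cast hi
  · intro h
    ext i
    simp [coeffVec_apply, h]

theorem coeffVec_eq_iff (hm : 0 < m) {k l : F[X]} :
    coeffVec m k = coeffVec m l ↔ X ^ m - 1 ∣ k - l := by
  rw [← coeffVec_eq_zero_iff hm, map_sub, sub_eq_zero]

theorem coeffVec_X_pow (hm : 0 < m) (j : ℕ) (i : Fin m) :
    coeffVec m (X ^ j : F[X]) i = if (i : ℕ) = j % m then 1 else 0 := by
  have h : coeffVec m (X ^ j : F[X]) = coeffVec m (X ^ (j % m)) := by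
    rw [coeffVec_eq_iff hm]
    have h1 : (X ^ j - X ^ (j % m) : F[X]) = X ^ (j % m) * ((X ^ m) ^ (j / m) - 1) := by
      rw [mul_sub, mul_one, ← pow_mul, ← pow_add, Nat.mod_add_div]
    rw [h1]
    exact (sub_one_dvd_pow_sub_one _ _).mul_left _
  rw [h, coeffVec_apply, (modByMonic_eq_self_iff (monic_X_pow_sub_one hm)).2, coeff_X_pow]
  rw [degree_eq_natDegree (monic_X_pow_sub_one hm).ne_zero, natDegree_X_pow_sub_one, degree_X_pow]
  exact_mod_cast Nat.mod_lt j hm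

theorem dvd_conj_sub_comp (k : F[X]) :
    X ^ m - 1 ∣ conj m k - k.comp (X ^ (m - 1)) := by
  refine ⟨-(k.comp (X ^ (m - 1)) /ₘ (X ^ m - 1)), ?_⟩
  have h := modByMonic_add_div (k.comp (X ^ (m - 1))) (X ^ m - 1 : F[X])
  change k.comp (X ^ (m - 1)) %ₘ (X ^ m - 1) - _ = _
  linear_combination h

/-- The dot product of coefficient vectors is the constant coefficient of `a(x) d(x⁻¹)`. -/
theorem dotProduct_coeffVec (hm : 0 < m) (a d : F[X]) :
    coeffVec m a ⬝ᵥ coeffVec m d = coeffVec m (a * d.comp (X ^ (m - 1))) ⟨0, hm⟩ := by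
  induction a using Polynomial.induction_on' with
  | add p q hp hq => rw [map_add, add_dotProduct, hp, hq, add_mul, map_add, Pi.add_apply]
  | monomial i r =>
    induction d using Polynomial.induction_on' with
    | add p q hp hq => rw [map_add, dotProduct_add, hp, hq, add_comp, mul_add, map_add,
        Pi.add_apply]
    | monomial j s =>
      have hmon : ∀ (k : ℕ) (t : F), monomial k t = t • (X ^ k : F[X]) := fun k t => by
        rw [smul_X_eq_monomial]
      rw [hmon, hmon, smul_comp, X_pow_comp, ← pow_mul, smul_mul_smul_comm, ← pow_add, map_smul,
        map_smul, map_smul, smul_dotProduct, dotProduct_smul, Pi.smul_apply, smul_smul]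
      congr 1
      rw [coeffVec_X_pow hm]
      simp only [dotProduct, coeffVec_X_pow hm, mul_ite, mul_one, mul_zero]
      rw [Finset.sum_eq_single ⟨j % m, Nat.mod_lt j hm⟩ _ (by simp)]
      · have h : j % m = i % m ↔ 0 = (i + (m - 1) * j) % m := by
          rw [eq_comm (a := 0), ← Nat.dvd_iff_mod_eq_zero, ← Nat.ModEq, Nat.modEq_iff_dvd,
            ← Int.natCast_dvd_natCast]
          -- The exponent `m - 1` acts as `-1` modulo `m`.
          have h2 : ((i + (m - 1) * j : ℕ) : ℤ) = ((i : ℤ) - j) + m * j := by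
            push_cast [Nat.cast_sub hm]
            ring
          rw [h2, Int.dvd_add_left (dvd_mul_right _ _)]
        simp [h]
      · intro b _ hb
        rw [if_neg]
        intro h
        exact hb (Fin.ext h)

end QuasiCyclic

/-! ### Self-orthogonality and dimension of the two-generator code -/

section TwoGenerator

variable {F : Type*} [Field F] {m : ℕ}

theorem mem_twoGenCode {g₁ g₂ v₁ v₂ : F[X]} {u : Vec F m} :
    u ∈ twoGenCode m g₁ g₂ v₁ v₂ ↔ ∃ a₁ a₂ : F[X],
      u = (coeffVec m (a₁ * g₁ + a₂ * (v₂ * g₂)), coeffVec m (a₁ * (v₁ * g₁) + a₂ * g₂)) := by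
  simp only [twoGenCode, qcCode, Submodule.mem_map, Submodule.restrictScalars_mem,
    Submodule.mem_span_pair]
  constructor
  · rintro ⟨_, ⟨a₁, a₂, rfl⟩, rfl⟩
    exact ⟨a₁, a₂, rfl⟩
  · rintro ⟨a₁, a₂, rfl⟩
    exact ⟨_, ⟨a₁, a₂, rfl⟩, rfl⟩

theorem sympInner_coeffVec (hm : 0 < m) (a b c d : F[X]) :
    sympInner (coeffVec m a, coeffVec m b) (coeffVec m c, coeffVec m d) =
      coeffVec m (a * d.comp (X ^ (m - 1)) - b * c.comp (X ^ (m - 1))) ⟨0, hm⟩ := by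
  rw [map_sub, Pi.sub_apply, ← dotProduct_coeffVec hm, ← dotProduct_coeffVec hm]
  simp [sympInner, dotProduct, Finset.sum_sub_distrib]

theorem sympInner_coeffVec_eq_zero (hm : 0 < m) {a b c d : F[X]}
    (h : X ^ m - 1 ∣ a * d.comp (X ^ (m - 1)) - b * c.comp (X ^ (m - 1))) (r s : F[X]) :
    sympInner (coeffVec m (r * a), coeffVec m (r * b))
      (coeffVec m (s * c), coeffVec m (s * d)) = 0 := by
  rw [sympInner_coeffVec hm, (coeffVec_eq_zero_iff hm).2, Pi.zero_apply]
  have h1 : r * a * (s * d).comp (X ^ (m - 1)) - r * b * (s * c).comp (X ^ (m - 1)) =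
      r * s.comp (X ^ (m - 1)) * (a * d.comp (X ^ (m - 1)) - b * c.comp (X ^ (m - 1))) := by
    rw [mul_comp, mul_comp]
    ring
  rw [h1]
  exact h.mul_left _

theorem sympInner_add_left (u v w : Vec F m) :
    sympInner (u + v) w = sympInner u w + sympInner v w := by
  simp only [sympInner, ← Finset.sum_add_distrib]
  exact Finset.sum_congr rfl fun i _ => by simp only [Prod.fst_add, Prod.snd_add, Pi.add_apply]; ring

theorem sympInner_swap (u v : Vec F m) : sympInner u v = -sympInner v u := by
  simp only [sympInner, ← Finset.sum_neg_distrib]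
  exact Finset.sum_congr rfl fun i _ => by ring

theorem sympInner_add_right (u v w : Vec F m) :
    sympInner u (v + w) = sympInner u v + sympInner u w := by
  rw [sympInner_swap, sympInner_add_left, neg_add, ← sympInner_swap, ← sympInner_swap]

/-- Serves to pass from `conj`, which is reduced, to the substitution `x ↦ x ^ (m - 1)`, which is a
ring homomorphism. -/
theorem dvd_of_dvd_mul_conj {f g h k l : F[X]} (hf : f = g * h) (hd : h ∣ k)
    (hkl : f ∣ k - l) : f ∣ g * l := by
  have h1 : f ∣ g * k := hf ▸ mul_dvd_mul_left g hd
  have h2 : g * l = g * k - g * (k - l) := by ring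
  rw [h2]
  exact dvd_sub h1 (hkl.mul_left g)

theorem isSympSelfOrthogonal_twoGenCode (hm : 0 < m) {g₁ g₂ v₁ v₂ h₁ h₂ : F[X]}
    (hh₁ : X ^ m - 1 = g₁ * h₁) (hh₂ : X ^ m - 1 = g₂ * h₂)
    (h11 : h₁ ∣ conj m g₁ * (conj m v₁ - v₁))
    (h12 : h₁ ∣ conj m g₂ * (1 - conj m v₂ * v₁))
    (h22 : h₂ ∣ conj m g₂ * (v₂ - conj m v₂)) :
    IsSympSelfOrthogonal (twoGenCode m g₁ g₂ v₁ v₂) := by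
  have e : ∀ k : F[X], ∃ t, conj m k - k.comp (X ^ (m - 1)) = (X ^ m - 1) * t :=
    dvd_conj_sub_comp
  obtain ⟨s₁, hs₁⟩ := e g₁
  obtain ⟨s₂, hs₂⟩ := e g₂
  obtain ⟨t₁, ht₁⟩ := e v₁
  obtain ⟨t₂, ht₂⟩ := e v₂
  have H11 : X ^ m - 1 ∣ g₁ * (v₁ * g₁).comp (X ^ (m - 1)) -
      v₁ * g₁ * g₁.comp (X ^ (m - 1)) := by
    have h := dvd_of_dvd_mul_conj (l := g₁.comp (X ^ (m - 1)) * (v₁.comp (X ^ (m - 1)) - v₁))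
      hh₁ h11 ⟨s₁ * (conj m v₁ - v₁) + g₁.comp (X ^ (m - 1)) * t₁, by
        linear_combination (conj m v₁ - v₁) * hs₁ + g₁.comp (X ^ (m - 1)) * ht₁⟩
    rw [mul_comp]
    convert h using 1
    ring
  have H12 : X ^ m - 1 ∣ g₁ * g₂.comp (X ^ (m - 1)) -
      v₁ * g₁ * (v₂ * g₂).comp (X ^ (m - 1)) := by
    have h := dvd_of_dvd_mul_conj
      (l := g₂.comp (X ^ (m - 1)) * (1 - v₂.comp (X ^ (m - 1)) * v₁))
      hh₁ h12 ⟨s₂ * (1 - conj m v₂ * v₁) - g₂.comp (X ^ (m - 1)) * t₂ * v₁, by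
        linear_combination (1 - conj m v₂ * v₁) * hs₂ - g₂.comp (X ^ (m - 1)) * v₁ * ht₂⟩
    rw [mul_comp]
    convert h using 1
    ring
  have H22 : X ^ m - 1 ∣ v₂ * g₂ * g₂.comp (X ^ (m - 1)) -
      g₂ * (v₂ * g₂).comp (X ^ (m - 1)) := by
    have h := dvd_of_dvd_mul_conj (l := g₂.comp (X ^ (m - 1)) * (v₂ - v₂.comp (X ^ (m - 1))))
      hh₂ h22 ⟨s₂ * (v₂ - conj m v₂) - g₂.comp (X ^ (m - 1)) * t₂, by
        linear_combination (v₂ - conj m v₂) * hs₂ - g₂.comp (X ^ (m - 1)) * ht₂⟩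
    rw [mul_comp]
    convert h using 1
    ring
  intro u hu w hw
  obtain ⟨a₁, a₂, rfl⟩ := mem_twoGenCode.1 hu
  obtain ⟨b₁, b₂, rfl⟩ := mem_twoGenCode.1 hw
  simp only [map_add, ← Prod.mk_add_mk]
  rw [sympInner_add_left, sympInner_add_right, sympInner_add_right,
    sympInner_coeffVec_eq_zero hm H11, sympInner_coeffVec_eq_zero hm H12,
    sympInner_coeffVec_eq_zero hm H22, sympInner_swap, sympInner_coeffVec_eq_zero hm H12]
  simp

/-- The codeword with coefficients `a₁`, `a₂` of degrees less than `k₁`, `k₂`. -/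
def twoGenParam (m k₁ k₂ : ℕ) (g₁ g₂ v₁ v₂ : F[X]) :
    (degreeLT F k₁ × degreeLT F k₂) →ₗ[F] Vec F m where
  toFun a := (coeffVec m (a.1.1 * g₁ + a.2.1 * (v₂ * g₂)),
    coeffVec m (a.1.1 * (v₁ * g₁) + a.2.1 * g₂))
  map_add' a b := by
    refine Prod.ext ?_ ?_ <;> refine Eq.trans (congrArg (coeffVec m) ?_) (map_add _ _ _) <;>
      simp only [Prod.fst_add, Prod.snd_add, Submodule.coe_add] <;> ring
  map_smul' r a := by
    refine Prod.ext ?_ ?_ <;> refine Eq.trans (congrArg (coeffVec m) ?_) (map_smul _ _ _) <;>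
      simp only [Prod.smul_fst, Prod.smul_snd, Submodule.coe_smul, smul_add, smul_mul_assoc,
        RingHom.id_apply]

theorem finrank_degreeLT (k : ℕ) : Module.finrank F (degreeLT F k) = k := by
  rw [(degreeLTEquiv F k).finrank_eq, Module.finrank_fin_fun]

instance finite_degreeLT (k : ℕ) : Module.Finite F (degreeLT F k) :=
  Module.Finite.equiv (degreeLTEquiv F k).symm

theorem eq_zero_of_mem_degreeLT_of_dvd_mul {f g h a : F[X]} (hf : f = g * h) (hg : g ≠ 0)
    (ha : a ∈ degreeLT F h.natDegree) (hd : f ∣ g * a) : a = 0 := by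
  by_contra h0
  rw [hf] at hd
  have h1 := natDegree_le_of_dvd ((mul_dvd_mul_iff_left hg).1 hd) h0
  rw [mem_degreeLT, degree_eq_natDegree h0, Nat.cast_lt] at ha
  omega

theorem finrank_twoGenCode (hm : 0 < m) {g₁ g₂ v₁ v₂ h₁ h₂ : F[X]}
    (hg₁ : g₁.Monic) (hg₂ : g₂.Monic)
    (hh₁ : X ^ m - 1 = g₁ * h₁) (hh₂ : X ^ m - 1 = g₂ * h₂)
    (hv : IsCoprime (v₁ * v₂ - 1) (X ^ m - 1)) :
    Module.finrank F (twoGenCode m g₁ g₂ v₁ v₂) = h₁.natDegree + h₂.natDegree := by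
  have hm₁ : h₁.Monic := hg₁.of_mul_monic_left (hh₁ ▸ monic_X_pow_sub_one hm)
  have hm₂ : h₂.Monic := hg₂.of_mul_monic_left (hh₂ ▸ monic_X_pow_sub_one hm)
  have hinj : Function.Injective (twoGenParam m h₁.natDegree h₂.natDegree g₁ g₂ v₁ v₂) := by
    rw [← LinearMap.ker_eq_bot, LinearMap.ker_eq_bot']
    rintro ⟨⟨a₁, ha₁⟩, a₂, ha₂⟩ h
    obtain ⟨e₁, e₂⟩ := Prod.mk.inj h
    replace e₁ := (coeffVec_eq_zero_iff hm).1 e₁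
    replace e₂ := (coeffVec_eq_zero_iff hm).1 e₂
    -- Eliminating `a₂` leaves `(v₁ v₂ - 1) g₁ a₁`, whose first factor is coprime to `x ^ m - 1`.
    have d₁ : X ^ m - 1 ∣ g₁ * a₁ := hv.symm.dvd_of_dvd_mul_left (by
      convert dvd_sub (e₂.mul_left v₂) e₁ using 1
      ring)
    have d₂ : X ^ m - 1 ∣ g₂ * a₂ := hv.symm.dvd_of_dvd_mul_left (by
      convert dvd_sub (e₁.mul_left v₁) e₂ using 1
      ring)
    have z₁ := eq_zero_of_mem_degreeLT_of_dvd_mul hh₁ hg₁.ne_zero ha₁ d₁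
    have z₂ := eq_zero_of_mem_degreeLT_of_dvd_mul hh₂ hg₂.ne_zero ha₂ d₂
    exact Prod.ext (Subtype.ext z₁) (Subtype.ext z₂)
  have hrange : LinearMap.range (twoGenParam m h₁.natDegree h₂.natDegree g₁ g₂ v₁ v₂) =
      twoGenCode m g₁ g₂ v₁ v₂ := by
    ext u
    rw [LinearMap.mem_range, mem_twoGenCode]
    constructor
    · rintro ⟨a, rfl⟩
      exact ⟨a.1, a.2, rfl⟩
    · rintro ⟨a₁, a₂, rfl⟩
      have hdeg : ∀ {h : F[X]}, h.Monic → ∀ a : F[X], a %ₘ h ∈ degreeLT F h.natDegree :=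
        fun {h} hh a => by
          rw [mem_degreeLT, ← degree_eq_natDegree hh.ne_zero]
          exact degree_modByMonic_lt _ hh
      -- Changing `aᵢ` by a multiple of `hᵢ` changes `aᵢ gᵢ` by a multiple of `x ^ m - 1`.
      refine ⟨(⟨a₁ %ₘ h₁, hdeg hm₁ _⟩, ⟨a₂ %ₘ h₂, hdeg hm₂ _⟩), ?_⟩
      have r₁ := modByMonic_add_div a₁ h₁
      have r₂ := modByMonic_add_div a₂ h₂
      refine Prod.ext ?_ ?_
      · refine (coeffVec_eq_iff hm).2 ⟨-(a₁ /ₘ h₁) - v₂ * (a₂ /ₘ h₂), ?_⟩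
        linear_combination g₁ * r₁ + v₂ * g₂ * r₂ + (a₁ /ₘ h₁) * hh₁ + v₂ * (a₂ /ₘ h₂) * hh₂
      · refine (coeffVec_eq_iff hm).2 ⟨-v₁ * (a₁ /ₘ h₁) - (a₂ /ₘ h₂), ?_⟩
        linear_combination v₁ * g₁ * r₁ + g₂ * r₂ + v₁ * (a₁ /ₘ h₁) * hh₁ + (a₂ /ₘ h₂) * hh₂
  rw [← hrange, LinearMap.finrank_range_of_inj hinj, Module.finrank_prod, finrank_degreeLT,
    finrank_degreeLT]

end TwoGenerator

end QCStab

end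

theorem mainTheorem8 {F : Type*} [Field F] [Fintype F] [DecidableEq F]
    (m : ℕ) (hm : 0 < m) (g₁ g₂ v₁ v₂ h₁ h₂ : F[X])
    (hg₁ : g₁.Monic) (hg₂ : g₂.Monic)
    (hh₁ : X ^ m - 1 = g₁ * h₁) (hh₂ : X ^ m - 1 = g₂ * h₂)
    (hv : IsCoprime (v₁ * v₂ - 1) (X ^ m - 1))
    (h11 : h₁ ∣ QCStab.conj m g₁ * (QCStab.conj m v₁ - v₁))
    (h12 : h₁ ∣ QCStab.conj m g₂ * (1 - QCStab.conj m v₂ * v₁))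
    (h22 : h₂ ∣ QCStab.conj m g₂ * (v₂ - QCStab.conj m v₂)) :
    QCStab.IsSympSelfOrthogonal (QCStab.twoGenCode m g₁ g₂ v₁ v₂) ∧
    (Module.finrank F (QCStab.twoGenCode m g₁ g₂ v₁ v₂) : ℤ)
      = 2 * m - g₁.natDegree - g₂.natDegree ∧
    m ≤ g₁.natDegree + g₂.natDegree ∧
    ∃ Q : Submodule ℂ (QCStab.StateSpace F m),
      QCStab.IsStabilizerCodeWith Q (g₁.natDegree + g₂.natDegree - m)
        (QCStab.minSympWeight
          ((QCStab.sympDual (QCStab.twoGenCode m g₁ g₂ v₁ v₂) : Set (QCStab.Vec F m)) \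
            (QCStab.twoGenCode m g₁ g₂ v₁ v₂ : Set (QCStab.Vec F m)))) := by
  have hC := QCStab.isSympSelfOrthogonal_twoGenCode hm hh₁ hh₂ h11 h12 h22
  have hrank := QCStab.finrank_twoGenCode hm hg₁ hg₂ hh₁ hh₂ hv
  have hne : g₁ * h₁ ≠ 0 := hh₁ ▸ (QCStab.monic_X_pow_sub_one hm).ne_zero
  have hne' : g₂ * h₂ ≠ 0 := hh₂ ▸ (QCStab.monic_X_pow_sub_one hm).ne_zero
  have hd₁ : g₁.natDegree + h₁.natDegree = m := by
    rw [← natDegree_mul (left_ne_zero_of_mul hne) (right_ne_zero_of_mul hne), ← hh₁,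
      QCStab.natDegree_X_pow_sub_one]
  have hd₂ : g₂.natDegree + h₂.natDegree = m := by
    rw [← natDegree_mul (left_ne_zero_of_mul hne') (right_ne_zero_of_mul hne'), ← hh₂,
      QCStab.natDegree_X_pow_sub_one]
  obtain ⟨hle, Q, hQ⟩ := QCStab.exists_isStabilizerCodeWith hC
  have hk : m - Module.finrank F (QCStab.twoGenCode m g₁ g₂ v₁ v₂) =
      g₁.natDegree + g₂.natDegree - m := by omega
  exact ⟨hC, by omega, by omega, Q, hk ▸ hQ⟩
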